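/- Let $d\ge 2$ be an integer and let $\chi\in C_c^\infty(-1,1)$ satisfy $\chi=1$ on $(-\tfrac12,\tfrac12)$. For $\kappa\in\mathbb R$ and $(x,t)\in\mathbb R^d\times\mathbb R$ the integral $$\mathcal W_\kappa(x,t)=\int_{\mathbb R^d}e^{i(x\cdot\xi+t|\xi|)}\,|\xi|^{-\frac{d+1}{2}+i\kappa}\,\chi(|\xi|)\,d\xi$$ converges absolutely, and there exist constants $C<\infty$ and $N>0$, depending only on $d$ and $\chi$, such that $$|\kappa\,\mathcal W_\kappa(x,t)|\le C(1+|\kappa|)^N|t|^{-\frac{d-1}{2}}$$ for all $\kappa\in\mathbb R$, $x\in\mathbb R^d$ and $t\in\mathbb R\setminus\{0\}$. -/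

import Mathlib

open MeasureTheory Set
open scoped ContDiff

/-- `χ` is a function in `C_c^∞(-1,1)` with `χ = 1` on `(-1/2, 1/2)`. -/
structure IsCutoff (χ : ℝ → ℂ) : Prop where
  smooth : ContDiff ℝ ∞ χ
  hasCompactSupport : HasCompactSupport χ
  tsupport_subset : tsupport χ ⊆ Ioo (-1) 1
  eq_one : ∀ r ∈ Ioo (-(1 / 2) : ℝ) (1 / 2), χ r = 1

/-- The integrand `e^{i(x·ξ + t|ξ|)} |ξ|^{-(d+1)/2 + iκ} χ(|ξ|)`. -/
noncomputable def waveIntegrand (d : ℕ) (χ : ℝ → ℂ) (κ : ℝ) (x : EuclideanSpace ℝ (Fin d))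
    (t : ℝ) (ξ : EuclideanSpace ℝ (Fin d)) : ℂ :=
  Complex.exp (Complex.I * ((inner ℝ x ξ + t * ‖ξ‖ : ℝ) : ℂ)) *
    (‖ξ‖ : ℂ) ^ (-((d : ℂ) + 1) / 2 + Complex.I * (κ : ℂ)) * χ ‖ξ‖

/-- The weighted wave oscillatory integral
`W_κ(x,t) = ∫ e^{i(x·ξ + t|ξ|)} |ξ|^{-(d+1)/2 + iκ} χ(|ξ|) dξ` over `ℝ^d`. -/
noncomputable def waveOsc (d : ℕ) (χ : ℝ → ℂ) (κ : ℝ) (x : EuclideanSpace ℝ (Fin d))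
    (t : ℝ) : ℂ :=
  ∫ ξ : EuclideanSpace ℝ (Fin d), waveIntegrand d χ κ x t ξ

/-!
In polar coordinates adapted to the direction of `x`, with `r = ‖ξ‖` and `θ` the angle between `x`
and `ξ`, the wave integral in dimension `d = m + 2` is a constant multiple of
`∫ r ∫ θ, sin^m θ · r^{(m-1)/2 + iκ} χ(r) e^{ir(t + ‖x‖ cos θ)}`
(`exists_waveOsc_eq`, which rests on `exists_integral_inner_norm_eq`).

If `2 ‖x‖ ≤ |t|`, then for every `θ` the frequency `t + ‖x‖ cos θ` has size at least `|t| / 2`, and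
the integral in `r` of an amplitude of degree `(m-1)/2` decays like the frequency to the power
`-(m+1)/2 = -(d-1)/2`. This is repeated integration by parts
(`exists_norm_integral_Ioi_oscAmp_le_of_lt`, `exists_norm_integral_Ioi_zero_oscAmp_le`), each step
costing one power of `1 + |κ|`.

If `2 ‖x‖ > |t|`, the integral in `θ` is taken first. It gives the function
`sphereSlice m (‖x‖ r)`, a Bessel function up to normalisation. Its differential equation, after
the Liouville transform, is a perturbation of `u'' + u = 0` by an integrable potential, so
`sphereSlice m y = y^{-(m+1)/2} (c₁ e^{iy} + c₂ e^{-iy} + O(1/y))`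
(`exists_norm_sphereSlice_sub_le`); no other information about Bessel functions is used. The part
`r ≤ 1/‖x‖` and the error term are estimated by absolute values. What remains is
`‖x‖^{-(m+1)/2}` times the integrals of `r^{-1+iκ} χ(r) e^{ir(t ± ‖x‖)}` over `r > 1/‖x‖`. In
absolute value these diverge logarithmically as `‖x‖ → ∞`, and `t ± ‖x‖` may vanish, but
`κ r^{-1+iκ}` is the derivative of a bounded function, so that multiplied by `κ` they are bounded
uniformly (`exists_norm_mul_integral_Ioi_oscAmp_le`).
-/

open Filter Topology Complex

/-! ### Oscillatory integrals on a half-line -/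

/-- The amplitude `r^z χ(r) e^{isr}` of the one-dimensional oscillatory integrals. -/
noncomputable def oscAmp (χ : ℝ → ℂ) (z : ℂ) (s r : ℝ) : ℂ :=
  (r : ℂ) ^ z * χ r * exp (I * s * r)

lemma norm_exp_I_mul_mul (s r : ℝ) : ‖exp (I * s * r)‖ = 1 := by
  rw [show I * (s : ℂ) * r = ((s * r : ℝ) : ℂ) * I by push_cast; ring]
  exact norm_exp_ofReal_mul_I _

lemma norm_oscAmp (χ : ℝ → ℂ) (z : ℂ) (s : ℝ) {r : ℝ} (hr : 0 < r) :
    ‖oscAmp χ z s r‖ = r ^ z.re * ‖χ r‖ := by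
  rw [oscAmp, norm_mul, norm_mul, norm_exp_I_mul_mul, mul_one, norm_cpow_eq_rpow_re_of_pos hr]

lemma oscAmp_eq_zero {χ : ℝ → ℂ} (hsupp : tsupport χ ⊆ Ioo (-1) 1) (z : ℂ) (s : ℝ) {r : ℝ}
    (hr : 1 ≤ r) : oscAmp χ z s r = 0 := by
  have : χ r = 0 := image_eq_zero_of_notMem_tsupport fun h => absurd (hsupp h).2 (not_lt.2 hr)
  simp [oscAmp, this]

lemma hasDerivAt_oscAmp {χ : ℝ → ℂ} (hχ : ContDiff ℝ ∞ χ) (z : ℂ) (s : ℝ) {r : ℝ} (hr : 0 < r) :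
    HasDerivAt (oscAmp χ z s)
      (z * oscAmp χ (z - 1) s r + oscAmp (deriv χ) z s r + I * s * oscAmp χ z s r) r := by
  have h1 : HasDerivAt (fun r : ℝ => (r : ℂ) ^ z) (z * (r : ℂ) ^ (z - 1)) r := by
    have h : HasDerivAt (fun w : ℂ => w ^ z) (z * (r : ℂ) ^ (z - 1) * 1) (r : ℂ) :=
      (hasDerivAt_id (r : ℂ)).cpow_const (Or.inl (by simpa using hr))
    simpa using h.comp_ofReal
  have h2 : HasDerivAt χ (deriv χ r) r :=
    (hχ.differentiable (by simp)).differentiableAt.hasDerivAt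
  have h3 : HasDerivAt (fun r : ℝ => exp (I * s * r)) (exp (I * s * r) * (I * s)) r := by
    have h := (((hasDerivAt_id (r : ℂ)).const_mul (I * (s : ℂ))).cexp).comp_ofReal
    simpa using h
  have := (h1.mul h2).mul h3
  refine this.congr_deriv ?_
  simp only [oscAmp, Pi.mul_apply]
  ring

lemma continuousOn_oscAmp {χ : ℝ → ℂ} (hχ : Continuous χ) (z : ℂ) (s : ℝ) :
    ContinuousOn (oscAmp χ z s) (Ioi 0) := by
  intro r hr
  have h1 : ContinuousAt (fun r : ℝ => (r : ℂ) ^ z) r :=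
    (continuousAt_cpow_const (Or.inl (by simpa using hr))).comp continuous_ofReal.continuousAt
  refine ContinuousAt.continuousWithinAt ?_
  exact (h1.mul hχ.continuousAt).mul (by fun_prop)

lemma measurable_oscAmp {χ : ℝ → ℂ} (hχ : Continuous χ) (z : ℂ) (s : ℝ) :
    Measurable (oscAmp χ z s) := by
  have := hχ.measurable
  unfold oscAmp
  fun_prop

lemma integrableOn_oscAmp {χ : ℝ → ℂ} (hχ : Continuous χ) (hsupp : tsupport χ ⊆ Ioo (-1) 1)
    (z : ℂ) (s : ℝ) {δ : ℝ} (hδ : 0 < δ) : IntegrableOn (oscAmp χ z s) (Ioi δ) := by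
  have h1 : IntegrableOn (oscAmp χ z s) (Icc δ (max δ 1)) :=
    ((continuousOn_oscAmp hχ z s).mono fun r hr => hδ.trans_le hr.1).integrableOn_Icc
  have h2 : IntegrableOn (oscAmp χ z s) (Ioi (max δ 1)) :=
    integrableOn_zero.congr_fun
      (fun r hr => (oscAmp_eq_zero hsupp z s ((le_max_right δ 1).trans (le_of_lt hr))).symm)
      measurableSet_Ioi
  refine (h1.union h2).mono_set fun r hr => ?_
  rcases le_or_gt r (max δ 1) with h | h
  · exact Or.inl ⟨le_of_lt hr, h⟩
  · exact Or.inr h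

lemma exists_norm_le_of_tsupport_subset {χ : ℝ → ℂ} (hχ : Continuous χ)
    (hsupp : tsupport χ ⊆ Ioo (-1) 1) : ∃ M : ℝ, 0 ≤ M ∧ ∀ r, ‖χ r‖ ≤ M := by
  have hc : HasCompactSupport χ :=
    isCompact_Icc.of_isClosed_subset (isClosed_tsupport χ) (hsupp.trans Ioo_subset_Icc_self)
  obtain ⟨M, hM⟩ := hc.exists_bound_of_continuous hχ
  exact ⟨M, (norm_nonneg _).trans (hM 0), hM⟩

lemma tsupport_id_mul_deriv_subset {χ : ℝ → ℂ} (hsupp : tsupport χ ⊆ Ioo (-1) 1) :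
    tsupport (fun r : ℝ => (r : ℂ) * deriv χ r) ⊆ Ioo (-1) 1 :=
  (tsupport_mul_subset_right (f := fun r : ℝ => (r : ℂ))).trans
    ((tsupport_deriv_subset (𝕜 := ℝ)).trans hsupp)

lemma contDiff_id_mul_deriv {χ : ℝ → ℂ} (hχ : ContDiff ℝ ∞ χ) :
    ContDiff ℝ ∞ (fun r : ℝ => (r : ℂ) * deriv χ r) :=
  ofRealCLM.contDiff.mul (contDiff_infty_iff_deriv.1 hχ).2

lemma oscAmp_id_mul {χ : ℝ → ℂ} (z : ℂ) (s : ℝ) {r : ℝ} (hr : 0 < r) :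
    oscAmp (fun r : ℝ => (r : ℂ) * χ r) (z - 1) s r = oscAmp χ z s r := by
  have h0 : (r : ℂ) ≠ 0 := by exact_mod_cast hr.ne'
  rw [oscAmp, oscAmp, cpow_sub _ _ h0, cpow_one]
  field_simp

/-- Integration by parts against `e^{isr}`. -/
lemma integral_Ioi_oscAmp_by_parts {χ : ℝ → ℂ} (hχ : ContDiff ℝ ∞ χ)
    (hsupp : tsupport χ ⊆ Ioo (-1) 1) (z : ℂ) (s : ℝ) {δ : ℝ} (hδ : 0 < δ) :
    I * s * ∫ r in Ioi δ, oscAmp χ z s r =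
      -oscAmp χ z s δ - z * (∫ r in Ioi δ, oscAmp χ (z - 1) s r) -
        ∫ r in Ioi δ, oscAmp (fun r : ℝ => (r : ℂ) * deriv χ r) (z - 1) s r := by
  have hχ' := (contDiff_infty_iff_deriv.1 hχ).2.continuous
  have hs' : tsupport (deriv χ) ⊆ Ioo (-1) 1 := (tsupport_deriv_subset (𝕜 := ℝ)).trans hsupp
  have i1 := (integrableOn_oscAmp hχ.continuous hsupp (z - 1) s hδ).const_mul z
  have i2 := integrableOn_oscAmp hχ' hs' z s hδ
  have i3 := (integrableOn_oscAmp hχ.continuous hsupp z s hδ).const_mul (I * s)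
  have key := integral_Ioi_of_hasDerivAt_of_tendsto' (f := oscAmp χ z s) (a := δ) (m := 0)
    (fun r hr => hasDerivAt_oscAmp hχ z s (hδ.trans_le hr)) ((i1.add i2).add i3)
    (tendsto_const_nhds.congr' ((eventually_ge_atTop 1).mono
      fun r hr => (oscAmp_eq_zero hsupp z s hr).symm))
  have e2 : ∫ r in Ioi δ, oscAmp (fun r : ℝ => (r : ℂ) * deriv χ r) (z - 1) s r =
      ∫ r in Ioi δ, oscAmp (deriv χ) z s r :=
    setIntegral_congr_fun measurableSet_Ioi fun r hr => oscAmp_id_mul z s (hδ.trans hr)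
  have i12 : IntegrableOn
      (fun r => z * oscAmp χ (z - 1) s r + oscAmp (deriv χ) z s r) (Ioi δ) := i1.add i2
  rw [integral_add i12 i3, integral_add i1 i2, integral_const_mul, integral_const_mul]
    at key
  rw [e2]
  linear_combination key

/-- Repeated integration by parts: on a half-line on which the phase has already turned
(`δ |s| ≥ 1`) the integral of `r^{a + iκ} χ(r) e^{isr}` is as small as if the amplitude were
concentrated in `r ∼ δ`, up to polynomial growth in `κ`. The bound holds for any real `a`:
it is trivial for `a < -1`, and each integration by parts raises the range of `a` by one. -/
lemma exists_norm_integral_Ioi_oscAmp_le_of_lt (n : ℕ) : ∀ a : ℝ, a < n - 1 →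
    ∀ χ : ℝ → ℂ, ContDiff ℝ ∞ χ → tsupport χ ⊆ Ioo (-1) 1 →
    ∃ (C : ℝ) (N : ℕ), 0 ≤ C ∧ ∀ κ s δ : ℝ, 0 < δ → 1 ≤ δ * |s| →
      ‖∫ r in Ioi δ, oscAmp χ (a + I * κ) s r‖ ≤ C * (1 + |κ|) ^ N * δ ^ (a + 1) := by
  induction n with
  | zero =>
    intro a ha χ hχ hsupp
    have ha : a < -1 := by simpa using ha
    obtain ⟨M, hM0, hM⟩ := exists_norm_le_of_tsupport_subset hχ.continuous hsupp
    have h1 : 0 < -(a + 1) := by linarith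
    refine ⟨M / -(a + 1), 0, by positivity, fun κ s δ hδ _ => ?_⟩
    calc ‖∫ r in Ioi δ, oscAmp χ (a + I * κ) s r‖ ≤ ∫ r in Ioi δ, r ^ a * M := by
          refine norm_integral_le_of_norm_le
            ((integrableOn_Ioi_rpow_of_lt ha hδ).mul_const M) ?_
          filter_upwards [ae_restrict_mem measurableSet_Ioi] with r hr
          have hr0 : 0 < r := hδ.trans hr
          rw [norm_oscAmp _ _ _ hr0]
          simpa using mul_le_mul_of_nonneg_left (hM r) (Real.rpow_nonneg hr0.le a)
      _ = _ := by
          rw [integral_mul_const, integral_Ioi_rpow_of_lt ha hδ]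
          field_simp [show a + 1 ≠ 0 by linarith]
  | succ n ih =>
    intro a ha χ hχ hsupp
    obtain ⟨M, hM0, hM⟩ := exists_norm_le_of_tsupport_subset hχ.continuous hsupp
    have ha' : a - 1 < n - 1 := by push_cast at ha; linarith
    obtain ⟨C₁, N₁, hC₁, h₁⟩ := ih (a - 1) ha' χ hχ hsupp
    obtain ⟨C₂, N₂, hC₂, h₂⟩ := ih (a - 1) ha' _ (contDiff_id_mul_deriv hχ)
      (tsupport_id_mul_deriv_subset hsupp)
    refine ⟨M + (|a| + 1) * C₁ + C₂, N₁ + N₂ + 1, by positivity, fun κ s δ hδ hs => ?_⟩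
    have hpos : 0 < |s| := by
      by_contra h
      nlinarith [abs_nonneg s]
    have e := integral_Ioi_oscAmp_by_parts hχ hsupp (a + I * κ) s hδ
    have ez : (a : ℂ) + I * κ - 1 = ((a - 1 : ℝ) : ℂ) + I * κ := by push_cast; ring
    rw [ez] at e
    have b1 := h₁ κ s δ hδ hs
    have b2 := h₂ κ s δ hδ hs
    rw [sub_add_cancel] at b1 b2
    set K := 1 + |κ| with hK
    have hK1 : 1 ≤ K := by have := abs_nonneg κ; linarith
    have hz : ‖(a : ℂ) + I * κ‖ ≤ (|a| + 1) * K := by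
      refine (norm_add_le _ _).trans ?_
      simp only [norm_mul, norm_I, one_mul, norm_real, Real.norm_eq_abs]
      nlinarith [abs_nonneg a, abs_nonneg κ]
    have b0 : ‖oscAmp χ (a + I * κ) s δ‖ ≤ M * δ ^ a := by
      rw [norm_oscAmp _ _ _ hδ]
      have := mul_le_mul_of_nonneg_left (hM δ) (Real.rpow_nonneg hδ.le a)
      simpa [mul_comm] using this
    have hδa : 0 < δ ^ a := Real.rpow_pos_of_pos hδ a
    have p0 : (1 : ℝ) ≤ K ^ (N₁ + N₂ + 1) := one_le_pow₀ hK1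
    have p1 : K * K ^ N₁ ≤ K ^ (N₁ + N₂ + 1) := by
      rw [← pow_succ']
      exact pow_le_pow_right₀ hK1 (by omega)
    have p2 : K ^ N₂ ≤ K ^ (N₁ + N₂ + 1) := pow_le_pow_right₀ hK1 (by omega)
    set P := K ^ (N₁ + N₂ + 1)
    have hmain : |s| * ‖∫ r in Ioi δ, oscAmp χ (a + I * κ) s r‖ ≤
        (M + (|a| + 1) * C₁ + C₂) * P * δ ^ a := by
      calc |s| * ‖∫ r in Ioi δ, oscAmp χ (a + I * κ) s r‖
          = ‖I * s * ∫ r in Ioi δ, oscAmp χ (a + I * κ) s r‖ := by simp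
        _ ≤ M * δ ^ a + (|a| + 1) * K * (C₁ * K ^ N₁ * δ ^ a) + C₂ * K ^ N₂ * δ ^ a := by
            rw [e]
            refine (norm_sub_le _ _).trans (add_le_add ((norm_sub_le _ _).trans ?_) b2)
            rw [norm_neg, norm_mul]
            gcongr
        _ = (M * 1 + (|a| + 1) * C₁ * (K * K ^ N₁) + C₂ * K ^ N₂) * δ ^ a := by ring
        _ ≤ (M * P + (|a| + 1) * C₁ * P + C₂ * P) * δ ^ a := by gcongr
        _ = _ := by ring
    rw [Real.rpow_add_one hδ.ne']
    set T := ‖∫ r in Ioi δ, oscAmp χ (a + I * κ) s r‖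
    have hT : 0 ≤ T := norm_nonneg _
    calc T = 1 * T := (one_mul T).symm
      _ ≤ δ * |s| * T := by gcongr
      _ = δ * (|s| * T) := by ring
      _ ≤ δ * ((M + (|a| + 1) * C₁ + C₂) * P * δ ^ a) := by gcongr
      _ = _ := by ring

lemma exists_norm_integral_Ioi_oscAmp_le (a : ℝ) {χ : ℝ → ℂ} (hχ : ContDiff ℝ ∞ χ)
    (hsupp : tsupport χ ⊆ Ioo (-1) 1) :
    ∃ (C : ℝ) (N : ℕ), 0 ≤ C ∧ ∀ κ s δ : ℝ, 0 < δ → 1 ≤ δ * |s| →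
      ‖∫ r in Ioi δ, oscAmp χ (a + I * κ) s r‖ ≤ C * (1 + |κ|) ^ N * δ ^ (a + 1) := by
  obtain ⟨n, hn⟩ := exists_nat_gt (a + 1)
  exact exists_norm_integral_Ioi_oscAmp_le_of_lt n a (by linarith) χ hχ hsupp

/-- For `a > -1` the amplitude is integrable up to `0`, and the head of the integral is
controlled by absolute values. -/
lemma norm_integral_Ioc_oscAmp_le {χ : ℝ → ℂ} {M : ℝ} (hM : ∀ r, ‖χ r‖ ≤ M) {a : ℝ}
    (ha : -1 < a) (κ s : ℝ) {δ : ℝ} (hδ : 0 < δ) :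
    ‖∫ r in Ioc 0 δ, oscAmp χ (a + I * κ) s r‖ ≤ M / (a + 1) * δ ^ (a + 1) := by
  have hi : IntegrableOn (fun r : ℝ => r ^ a) (Ioc 0 δ) :=
    (intervalIntegral.intervalIntegrable_rpow' ha).1
  calc ‖∫ r in Ioc 0 δ, oscAmp χ (a + I * κ) s r‖ ≤ ∫ r in Ioc 0 δ, r ^ a * M := by
        refine norm_integral_le_of_norm_le (hi.mul_const M) ?_
        filter_upwards [ae_restrict_mem measurableSet_Ioc] with r hr
        rw [norm_oscAmp _ _ _ hr.1]
        simpa using mul_le_mul_of_nonneg_left (hM r) (Real.rpow_nonneg hr.1.le a)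
    _ = _ := by
        rw [integral_mul_const, ← intervalIntegral.integral_of_le hδ.le, integral_rpow (Or.inl ha),
          Real.zero_rpow (by linarith)]
        ring

lemma integrableOn_Ioi_zero_oscAmp {χ : ℝ → ℂ} (hχ : Continuous χ)
    (hsupp : tsupport χ ⊆ Ioo (-1) 1) {z : ℂ} (hz : -1 < z.re) (s : ℝ) :
    IntegrableOn (oscAmp χ z s) (Ioi 0) := by
  obtain ⟨M, hM0, hM⟩ := exists_norm_le_of_tsupport_subset hχ hsupp
  have hi : IntegrableOn (fun r : ℝ => r ^ z.re) (Ioc 0 1) :=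
    (intervalIntegral.intervalIntegrable_rpow' hz).1
  rw [← Ioc_union_Ioi_eq_Ioi zero_le_one]
  refine IntegrableOn.union ?_ (integrableOn_oscAmp hχ hsupp z s one_pos)
  refine (hi.mul_const M).mono' (measurable_oscAmp hχ z s).aestronglyMeasurable ?_
  filter_upwards [ae_restrict_mem measurableSet_Ioc] with r hr
  rw [norm_oscAmp _ _ _ hr.1]
  exact mul_le_mul_of_nonneg_left (hM r) (Real.rpow_nonneg hr.1.le _)

/-- The full half-line integral of a homogeneous amplitude of degree `a > -1` decays like
`|s|^{-(a+1)}`. -/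
lemma exists_norm_integral_Ioi_zero_oscAmp_le {a : ℝ} (ha : -1 < a) {χ : ℝ → ℂ}
    (hχ : ContDiff ℝ ∞ χ) (hsupp : tsupport χ ⊆ Ioo (-1) 1) :
    ∃ (C : ℝ) (N : ℕ), 0 ≤ C ∧ ∀ κ s : ℝ, s ≠ 0 →
      ‖∫ r in Ioi 0, oscAmp χ (a + I * κ) s r‖ ≤ C * (1 + |κ|) ^ N * |s| ^ (-(a + 1)) := by
  obtain ⟨M, hM0, hM⟩ := exists_norm_le_of_tsupport_subset hχ.continuous hsupp
  obtain ⟨C, N, hC, h⟩ := exists_norm_integral_Ioi_oscAmp_le a hχ hsupp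
  have ha1 : 0 < a + 1 := by linarith
  refine ⟨M / (a + 1) + C, N, by positivity, fun κ s hs => ?_⟩
  have hs0 : 0 < |s| := abs_pos.2 hs
  have hδ : 0 < |s|⁻¹ := inv_pos.2 hs0
  have hi := integrableOn_Ioi_zero_oscAmp hχ.continuous hsupp (z := a + I * κ) (by simpa) s
  rw [← Ioc_union_Ioi_eq_Ioi hδ.le, setIntegral_union (Ioc_disjoint_Ioi le_rfl) measurableSet_Ioi
    (hi.mono_set Ioc_subset_Ioi_self) (hi.mono_set (Ioi_subset_Ioi hδ.le))]
  refine (norm_add_le _ _).trans ?_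
  have b1 := norm_integral_Ioc_oscAmp_le hM ha κ s hδ
  have b2 := h κ s _ hδ (by rw [inv_mul_cancel₀ hs0.ne'])
  rw [Real.inv_rpow hs0.le, ← Real.rpow_neg hs0.le] at b1 b2
  have p0 : (1 : ℝ) ≤ (1 + |κ|) ^ N := one_le_pow₀ (by have := abs_nonneg κ; linarith)
  have hq : 0 ≤ |s| ^ (-(a + 1)) := Real.rpow_nonneg hs0.le _
  calc _ ≤ M / (a + 1) * 1 * |s| ^ (-(a + 1)) + C * (1 + |κ|) ^ N * |s| ^ (-(a + 1)) := by
        rw [mul_one]; exact add_le_add b1 b2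
    _ ≤ M / (a + 1) * (1 + |κ|) ^ N * |s| ^ (-(a + 1)) +
        C * (1 + |κ|) ^ N * |s| ^ (-(a + 1)) := by gcongr
    _ = _ := by ring

lemma norm_mul_integral_Ioc_oscAmp_le {χ : ℝ → ℂ} (hχ : ContDiff ℝ ∞ χ) {M M' : ℝ}
    (hM : ∀ r, ‖χ r‖ ≤ M) (hM' : ∀ r, ‖deriv χ r‖ ≤ M') (κ s : ℝ) {δ η : ℝ} (hδ : 0 < δ)
    (hδη : δ ≤ η) :
    ‖(κ : ℂ) * ∫ r in Ioc δ η, oscAmp χ (((-1 : ℝ) : ℂ) + I * κ) s r‖ ≤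
      2 * M + (M' + |s| * M) * (η - δ) := by
  have hχ' := (contDiff_infty_iff_deriv.1 hχ).2.continuous
  have hint : ∀ (φ : ℝ → ℂ) (z : ℂ), Continuous φ →
      IntervalIntegrable (oscAmp φ z s) volume δ η := fun φ z hφ =>
    ((continuousOn_oscAmp hφ z s).mono
      (by rw [uIcc_of_le hδη]; exact fun r hr => hδ.trans_le hr.1)).intervalIntegrable
  have i1 := (hint χ (I * κ - 1) hχ.continuous).const_mul (I * κ)
  have i2 := hint (deriv χ) (I * κ) hχ'
  have i3 := (hint χ (I * κ) hχ.continuous).const_mul (I * s)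
  have i23 : IntervalIntegrable
      (fun r => oscAmp (deriv χ) (I * κ) s r + I * s * oscAmp χ (I * κ) s r) volume δ η :=
    i2.add i3
  have key := intervalIntegral.integral_eq_sub_of_hasDerivAt
    (f := oscAmp χ (I * κ) s) (a := δ) (b := η)
    (f' := fun r => I * κ * oscAmp χ (I * κ - 1) s r +
      (oscAmp (deriv χ) (I * κ) s r + I * s * oscAmp χ (I * κ) s r))
    (fun r hr => (hasDerivAt_oscAmp hχ _ s
      (hδ.trans_le (by rw [uIcc_of_le hδη] at hr; exact hr.1))).congr_deriv (by ring))
    (i1.add i23)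
  rw [intervalIntegral.integral_add i1 i23, intervalIntegral.integral_const_mul] at key
  have hn : ∀ (φ : ℝ → ℂ) (r : ℝ), 0 < r → ‖oscAmp φ (I * κ) s r‖ = ‖φ r‖ := fun φ r hr => by
    simp [norm_oscAmp _ _ _ hr]
  have herr : ‖∫ r in δ..η, (oscAmp (deriv χ) (I * κ) s r + I * s * oscAmp χ (I * κ) s r)‖ ≤
      (M' + |s| * M) * |η - δ| := by
    refine intervalIntegral.norm_integral_le_of_norm_le_const fun r hr => ?_
    rw [uIoc_of_le hδη] at hr
    have hr0 : 0 < r := hδ.trans hr.1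
    refine (norm_add_le _ _).trans ?_
    rw [hn _ _ hr0, norm_mul, hn _ _ hr0, norm_mul, norm_I, one_mul, norm_real, Real.norm_eq_abs]
    exact add_le_add (hM' r) (mul_le_mul_of_nonneg_left (hM r) (abs_nonneg s))
  rw [abs_of_nonneg (sub_nonneg.2 hδη)] at herr
  rw [← intervalIntegral.integral_of_le hδη,
    show ((-1 : ℝ) : ℂ) + I * κ = I * κ - 1 by push_cast; ring]
  set A := ∫ r in δ..η, oscAmp χ (I * κ - 1) s r
  set B := ∫ r in δ..η, (oscAmp (deriv χ) (I * κ) s r + I * s * oscAmp χ (I * κ) s r)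
  have e : I * (κ * A) = oscAmp χ (I * κ) s η - oscAmp χ (I * κ) s δ - B := by
    linear_combination key
  calc ‖(κ : ℂ) * A‖ = ‖I * (κ * A)‖ := by rw [norm_mul I, norm_I, one_mul]
    _ ≤ M + M + (M' + |s| * M) * (η - δ) := by
        rw [e]
        refine (norm_sub_le _ _).trans (add_le_add ((norm_sub_le _ _).trans ?_) herr)
        rw [hn _ _ hδ, hn _ _ (hδ.trans_le hδη)]
        exact add_le_add (hM _) (hM _)
    _ = _ := by ring

/-- The factor `κ` removes the logarithmic divergence of `∫ r^{-1 + iκ} χ(r) e^{isr} dr`: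
since `iκ r^{iκ - 1}` is the derivative of the bounded function `r^{iκ}`, truncations of the
integral at `δ > 0` are bounded uniformly in `δ` and in `s`. -/
lemma exists_norm_mul_integral_Ioi_oscAmp_le {χ : ℝ → ℂ} (hχ : ContDiff ℝ ∞ χ)
    (hsupp : tsupport χ ⊆ Ioo (-1) 1) :
    ∃ (C : ℝ) (N : ℕ), 0 ≤ C ∧ ∀ κ s δ : ℝ, 0 < δ →
      ‖(κ : ℂ) * ∫ r in Ioi δ, oscAmp χ (((-1 : ℝ) : ℂ) + I * κ) s r‖ ≤
        C * (1 + |κ|) ^ N := by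
  obtain ⟨M, hM0, hM⟩ := exists_norm_le_of_tsupport_subset hχ.continuous hsupp
  obtain ⟨M', hM'0, hM'⟩ := exists_norm_le_of_tsupport_subset
    (contDiff_infty_iff_deriv.1 hχ).2.continuous
    ((tsupport_deriv_subset (𝕜 := ℝ)).trans hsupp)
  obtain ⟨C, N, hC, h⟩ := exists_norm_integral_Ioi_oscAmp_le (-1) hχ hsupp
  refine ⟨3 * M + M' + C, N + 1, by positivity, fun κ s δ hδ => ?_⟩
  have hK1 : 1 ≤ 1 + |κ| := by have := abs_nonneg κ; linarith
  have p0 : 1 ≤ (1 + |κ|) ^ (N + 1) := one_le_pow₀ hK1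
  -- Tails starting at a point where the phase has turned.
  have tail : ∀ η : ℝ, 0 < η → 1 ≤ η * |s| →
      ‖(κ : ℂ) * ∫ r in Ioi η, oscAmp χ (((-1 : ℝ) : ℂ) + I * κ) s r‖ ≤
        C * (1 + |κ|) ^ (N + 1) := by
    intro η hη hηs
    have b := h κ s η hη hηs
    rw [show (-1 : ℝ) + 1 = 0 by norm_num, Real.rpow_zero, mul_one] at b
    rw [norm_mul, norm_real, Real.norm_eq_abs]
    calc _ ≤ (1 + |κ|) * (C * (1 + |κ|) ^ N) := by
          gcongr
          linarith
      _ = _ := by ring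
  have zero : ∀ η : ℝ, 1 ≤ η → ∫ r in Ioi η, oscAmp χ (((-1 : ℝ) : ℂ) + I * κ) s r = 0 :=
    fun η hη => setIntegral_eq_zero_of_forall_eq_zero fun r hr =>
      oscAmp_eq_zero hsupp _ s (hη.trans (le_of_lt hr))
  -- `η` is the point where the phase turns, or the end of the support if that comes earlier.
  have split : ∀ η : ℝ, δ ≤ η → η ≤ 1 → |s| * η ≤ 1 →
      ‖(κ : ℂ) * ∫ r in Ioi η, oscAmp χ (((-1 : ℝ) : ℂ) + I * κ) s r‖ ≤
        C * (1 + |κ|) ^ (N + 1) →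
      ‖(κ : ℂ) * ∫ r in Ioi δ, oscAmp χ (((-1 : ℝ) : ℂ) + I * κ) s r‖ ≤
        (3 * M + M' + C) * (1 + |κ|) ^ (N + 1) := by
    intro η hδη hη1 hsη ht
    have hi := integrableOn_oscAmp hχ.continuous hsupp (((-1 : ℝ) : ℂ) + I * κ) s hδ
    rw [← Ioc_union_Ioi_eq_Ioi hδη, setIntegral_union (Ioc_disjoint_Ioi le_rfl)
      measurableSet_Ioi (hi.mono_set Ioc_subset_Ioi_self) (hi.mono_set (Ioi_subset_Ioi hδη)),
      mul_add]
    have b := norm_mul_integral_Ioc_oscAmp_le hχ hM hM' κ s hδ hδη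
    have b' : 2 * M + (M' + |s| * M) * (η - δ) ≤ 3 * M + M' := by
      have h1 : M' * (η - δ) ≤ M' * 1 := by gcongr; linarith
      have h2 : M * (|s| * (η - δ)) ≤ M * 1 := by
        gcongr
        nlinarith [abs_nonneg s]
      nlinarith
    calc _ ≤ (3 * M + M') * 1 + C * (1 + |κ|) ^ (N + 1) := by
          rw [mul_one]
          exact (norm_add_le _ _).trans (add_le_add (b.trans b') ht)
      _ ≤ (3 * M + M') * (1 + |κ|) ^ (N + 1) + C * (1 + |κ|) ^ (N + 1) := by gcongr
      _ = _ := by ring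
  rcases le_or_gt 1 δ with h1 | h1
  · rw [zero δ h1, mul_zero, norm_zero]
    positivity
  rcases le_or_gt 1 (δ * |s|) with h2 | h2
  · refine (tail δ hδ h2).trans ?_
    gcongr
    linarith
  rcases le_or_gt |s| 1 with h3 | h3
  · refine split 1 h1.le le_rfl (by simpa using h3) ?_
    rw [zero 1 le_rfl, mul_zero, norm_zero]
    positivity
  · have hs0 : 0 < |s| := one_pos.trans h3
    refine split |s|⁻¹ ?_ (inv_le_one_of_one_le₀ h3.le) (by rw [mul_inv_cancel₀ hs0.ne'])
      (tail _ (inv_pos.2 hs0) (by rw [inv_mul_cancel₀ hs0.ne']))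
    rw [← one_div, le_div_iff₀ hs0]
    exact h2.le

/-! ### Asymptotics of the slice integral of the sphere -/

/-- Energy estimate: `u² + u'²` stays bounded along solutions of `u'' = (q / y² - 1) u`. -/
lemma exists_abs_le_of_hasDerivAt {u v : ℝ → ℝ} {q : ℝ}
    (hu : ∀ y, 1 ≤ y → HasDerivAt u (v y) y)
    (hv : ∀ y, 1 ≤ y → HasDerivAt v ((q / y ^ 2 - 1) * u y) y) :
    ∃ B : ℝ, 0 ≤ B ∧ ∀ y, 1 ≤ y → |u y| ≤ B := by
  set G : ℝ → ℝ := fun y => (u y ^ 2 + v y ^ 2) * Real.exp (|q| / y)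
  have hG : ∀ y, 1 ≤ y → HasDerivAt G ((2 * u y * v y + 2 * v y * ((q / y ^ 2 - 1) * u y)) *
      Real.exp (|q| / y) + (u y ^ 2 + v y ^ 2) *
        (Real.exp (|q| / y) * (|q| * -(y ^ 2)⁻¹))) y := by
    intro y hy
    have h1 := ((hu y hy).pow 2).add ((hv y hy).pow 2)
    have h2 := ((hasDerivAt_inv (show y ≠ 0 by linarith)).const_mul |q|).exp
    exact ((h1.mul h2)).congr_deriv (by simp [div_eq_mul_inv])
  have hanti : AntitoneOn G (Ici 1) := by
    refine antitoneOn_of_deriv_nonpos (convex_Ici 1)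
      (fun y hy => (hG y hy).continuousAt.continuousWithinAt)
      (fun y hy => ?_) (fun y hy => ?_)
    · rw [interior_Ici] at hy
      exact (hG y (le_of_lt hy)).differentiableAt.differentiableWithinAt
    · rw [interior_Ici] at hy
      rw [(hG y (le_of_lt hy)).deriv]
      have hy0 : 0 < (y ^ 2)⁻¹ := by have : (0 : ℝ) < y := one_pos.trans hy; positivity
      have e : (2 * u y * v y + 2 * v y * ((q / y ^ 2 - 1) * u y)) * Real.exp (|q| / y) +
          (u y ^ 2 + v y ^ 2) * (Real.exp (|q| / y) * (|q| * -(y ^ 2)⁻¹)) =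
          -(Real.exp (|q| / y) * (y ^ 2)⁻¹ *
            (|q| * (u y ^ 2 + v y ^ 2) - q * (2 * u y * v y))) := by
        rw [div_eq_mul_inv q]; ring
      rw [e, neg_nonpos]
      refine mul_nonneg (by positivity) ?_
      nlinarith [mul_nonneg (sub_nonneg.2 (le_abs_self q)) (sq_nonneg (u y + v y)),
        mul_nonneg (sub_nonneg.2 (neg_abs_le q)) (sq_nonneg (u y - v y))]
  refine ⟨Real.sqrt (G 1), Real.sqrt_nonneg _, fun y hy => Real.abs_le_sqrt ?_⟩
  have h1 : G y ≤ G 1 := hanti (mem_Ici.2 le_rfl) hy hy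
  refine le_trans ?_ h1
  have h2 : (1 : ℝ) ≤ Real.exp (|q| / y) := Real.one_le_exp (by positivity)
  have h3 : u y ^ 2 + v y ^ 2 ≤ G y := le_mul_of_one_le_right (by positivity) h2
  nlinarith [sq_nonneg (v y)]

/-- Solutions of `u'' = (q / y² - 1) u` are asymptotic to solutions of `u'' = -u`, by variation of
parameters: `e^{-iy} (u' + iu)` has an integrable derivative. -/
lemma exists_norm_sub_exp_le_of_hasDerivAt {u v : ℝ → ℝ} {q : ℝ}
    (hu : ∀ y, 1 ≤ y → HasDerivAt u (v y) y)
    (hv : ∀ y, 1 ≤ y → HasDerivAt v ((q / y ^ 2 - 1) * u y) y) :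
    ∃ (c₁ c₂ : ℂ) (C : ℝ), 0 ≤ C ∧ ∀ y : ℝ, 1 ≤ y →
      ‖(u y : ℂ) - (c₁ * exp (I * y) + c₂ * exp (-(I * y)))‖ ≤ C / y := by
  obtain ⟨B, hB0, hB⟩ := exists_abs_le_of_hasDerivAt hu hv
  set A : ℝ → ℂ := fun y => exp (-(I * y)) * ((v y : ℂ) + I * u y)
  set A' : ℝ → ℂ := fun y => exp (-(I * y)) * ((q / y ^ 2 * u y : ℝ) : ℂ)
  have hA : ∀ y, 1 ≤ y → HasDerivAt A (A' y) y := by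
    intro y hy
    have h1 : HasDerivAt (fun y : ℝ => exp (-(I * (y : ℂ)))) (exp (-(I * y)) * -(I * 1)) y :=
      (((hasDerivAt_id (y : ℂ)).const_mul I).neg.cexp).comp_ofReal
    have h2 : HasDerivAt (fun y : ℝ => (v y : ℂ) + I * u y)
        ((((q / y ^ 2 - 1) * u y : ℝ) : ℂ) + I * v y) y :=
      (hv y hy).ofReal_comp.add ((hu y hy).ofReal_comp.const_mul I)
    refine (h1.mul h2).congr_deriv ?_
    simp only [A']
    push_cast
    linear_combination (-exp (-(I * y)) * u y) * I_sq
  have hexp : ∀ y : ℝ, ‖exp (-(I * y))‖ = 1 := fun y => by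
    rw [show -(I * (y : ℂ)) = ((-y : ℝ) : ℂ) * I by push_cast; ring]
    exact norm_exp_ofReal_mul_I _
  have hexp' : ∀ y : ℝ, ‖exp (I * y)‖ = 1 := fun y => by
    rw [mul_comm]
    exact norm_exp_ofReal_mul_I _
  have hA'le : ∀ y, 1 ≤ y → ‖A' y‖ ≤ |q| * B * y ^ (-2 : ℝ) := by
    intro y hy
    have hy0 : 0 < y := by linarith
    rw [Real.rpow_neg hy0.le, Real.rpow_ofNat, norm_mul, hexp, one_mul, norm_real,
      Real.norm_eq_abs, abs_mul, abs_div, abs_of_pos (pow_pos hy0 2), div_eq_mul_inv,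
      mul_right_comm]
    have := hB y hy
    gcongr
  have hdom : ∀ y : ℝ, 1 ≤ y → IntegrableOn (fun y : ℝ => |q| * B * y ^ (-2 : ℝ)) (Ioi y) :=
    fun y hy => (integrableOn_Ioi_rpow_of_lt (by norm_num) (by linarith)).const_mul _
  have hA'int : ∀ y, 1 ≤ y → IntegrableOn A' (Ioi y) := by
    intro y hy
    refine (hdom y hy).mono' ?_ ?_
    · refine ContinuousOn.aestronglyMeasurable (fun r hr => ?_) measurableSet_Ioi
      have hr1 : 1 ≤ r := hy.trans (le_of_lt hr)
      have hr0 : 0 < r := by linarith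
      have h0 : r ^ 2 ≠ 0 := by positivity
      have hc : ContinuousAt (fun r : ℝ => q / r ^ 2 * u r) r :=
        (continuousAt_const.div (continuousAt_id.pow 2) h0).mul (hu r hr1).continuousAt
      have h1 : ContinuousAt (fun r : ℝ => ((q / r ^ 2 * u r : ℝ) : ℂ)) r :=
        continuous_ofReal.continuousAt.comp hc
      exact ((Continuous.continuousAt (by fun_prop)).mul h1).continuousWithinAt
    · filter_upwards [ae_restrict_mem measurableSet_Ioi] with r hr
      exact hA'le r (hy.trans (le_of_lt hr))
  set a := limUnder atTop A
  have hlim : Tendsto A atTop (𝓝 a) := tendsto_limUnder_of_hasDerivAt_of_integrableOn_Ioi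
    (fun y hy => hA y (le_of_lt hy)) (hA'int 1 le_rfl)
  have hAa : ∀ y, 1 ≤ y → ‖A y - a‖ ≤ |q| * B / y := by
    intro y hy
    have e := integral_Ioi_of_hasDerivAt_of_tendsto' (fun r hr => hA r (hy.trans hr))
      (hA'int y hy) hlim
    rw [norm_sub_rev, ← e]
    calc ‖∫ r in Ioi y, A' r‖ ≤ ∫ r in Ioi y, |q| * B * r ^ (-2 : ℝ) := by
          refine norm_integral_le_of_norm_le (hdom y hy) ?_
          filter_upwards [ae_restrict_mem measurableSet_Ioi] with r hr
          exact hA'le r (hy.trans (le_of_lt hr))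
      _ = |q| * B / y := by
          rw [integral_const_mul, integral_Ioi_rpow_of_lt (by norm_num) (by linarith),
            show (-2 : ℝ) + 1 = -1 by norm_num, Real.rpow_neg_one]
          ring
  refine ⟨a / (2 * I), -(starRingEnd ℂ a) / (2 * I), |q| * B, by positivity, fun y hy => ?_⟩
  have e1 : exp (I * y) * A y = v y + I * u y := by
    simp only [A]
    rw [← mul_assoc, ← Complex.exp_add, add_neg_cancel, Complex.exp_zero, one_mul]
  have e2 : exp (-(I * y)) * starRingEnd ℂ (A y) = v y - I * u y := by
    simp only [A, map_mul, map_add, ← Complex.exp_conj, map_neg, conj_I, conj_ofReal]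
    rw [← mul_assoc, ← Complex.exp_add]
    simp [sub_eq_add_neg]
  have e : (u y : ℂ) - (a / (2 * I) * exp (I * y) + -(starRingEnd ℂ a) / (2 * I) *
      exp (-(I * y))) = (exp (I * y) * (A y - a) -
        exp (-(I * y)) * starRingEnd ℂ (A y - a)) / (2 * I) := by
    rw [map_sub, mul_sub, mul_sub, e1, e2]
    field_simp
    ring
  rw [e, norm_div, norm_mul, norm_I, mul_one, Complex.norm_ofNat, div_le_iff₀ two_pos]
  refine (norm_sub_le _ _).trans ?_
  rw [norm_mul, norm_mul, hexp, hexp', RCLike.norm_conj, one_mul]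
  linarith [hAa y hy]

/-- The integral `∫₀^π cos(y cos θ) sinⁿ θ dθ`. Up to a constant it is the Fourier transform, at
distance `y` from the origin, of the surface measure of the unit sphere of `ℝ^{n+2}`. -/
noncomputable def sphereSlice (n : ℕ) (y : ℝ) : ℝ :=
  ∫ θ in (0 : ℝ)..Real.pi, Real.cos (y * Real.cos θ) * Real.sin θ ^ n

lemma hasDerivAt_sphereSlice (n : ℕ) (y : ℝ) :
    HasDerivAt (sphereSlice n)
      (∫ θ in (0 : ℝ)..Real.pi, -Real.sin (y * Real.cos θ) * Real.cos θ * Real.sin θ ^ n) y := by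
  refine (intervalIntegral.hasDerivAt_integral_of_dominated_loc_of_deriv_le
    (F := fun y θ => Real.cos (y * Real.cos θ) * Real.sin θ ^ n)
    (F' := fun y θ => -Real.sin (y * Real.cos θ) * Real.cos θ * Real.sin θ ^ n)
    (bound := fun _ => 1) univ_mem
    (Eventually.of_forall fun y => Continuous.aestronglyMeasurable (by fun_prop))
    (Continuous.intervalIntegrable (by fun_prop) _ _)
    (Continuous.aestronglyMeasurable (by fun_prop))
    (Eventually.of_forall fun θ _ y _ => ?_) intervalIntegrable_const
    (Eventually.of_forall fun θ _ y _ => ?_)).2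
  · rw [norm_mul, norm_mul, norm_neg, norm_pow]
    exact mul_le_one₀ (mul_le_one₀ (Real.abs_sin_le_one _) (norm_nonneg _)
      (Real.abs_cos_le_one _)) (by positivity)
      (pow_le_one₀ (norm_nonneg _) (Real.abs_sin_le_one _))
  · simpa using (((hasDerivAt_id y).mul_const (Real.cos θ)).cos).mul_const (Real.sin θ ^ n)

lemma hasDerivAt_deriv_sphereSlice (n : ℕ) (y : ℝ) :
    HasDerivAt (fun y => ∫ θ in (0 : ℝ)..Real.pi,
        -Real.sin (y * Real.cos θ) * Real.cos θ * Real.sin θ ^ n)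
      (∫ θ in (0 : ℝ)..Real.pi,
        -Real.cos (y * Real.cos θ) * Real.cos θ ^ 2 * Real.sin θ ^ n) y := by
  refine (intervalIntegral.hasDerivAt_integral_of_dominated_loc_of_deriv_le
    (F := fun y θ => -Real.sin (y * Real.cos θ) * Real.cos θ * Real.sin θ ^ n)
    (F' := fun y θ => -Real.cos (y * Real.cos θ) * Real.cos θ ^ 2 * Real.sin θ ^ n)
    (bound := fun _ => 1) univ_mem
    (Eventually.of_forall fun y => Continuous.aestronglyMeasurable (by fun_prop))
    (Continuous.intervalIntegrable (by fun_prop) _ _)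
    (Continuous.aestronglyMeasurable (by fun_prop))
    (Eventually.of_forall fun θ _ y _ => ?_) intervalIntegrable_const
    (Eventually.of_forall fun θ _ y _ => ?_)).2
  · rw [norm_mul, norm_mul, norm_neg, norm_pow, norm_pow]
    exact mul_le_one₀ (mul_le_one₀ (Real.abs_cos_le_one _) (by positivity)
      (pow_le_one₀ (norm_nonneg _) (Real.abs_cos_le_one _))) (by positivity)
      (pow_le_one₀ (norm_nonneg _) (Real.abs_sin_le_one _))
  · refine (((((hasDerivAt_id y).mul_const (Real.cos θ)).sin).neg.mul_const
      (Real.cos θ)).mul_const (Real.sin θ ^ n)).congr_deriv ?_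
    simp only [id]
    ring

/-- The Bessel-type equation `y (J'' + J) = -(n + 1) J'`. -/
lemma sphereSlice_ode (n : ℕ) (y : ℝ) :
    y * ((∫ θ in (0 : ℝ)..Real.pi,
        -Real.cos (y * Real.cos θ) * Real.cos θ ^ 2 * Real.sin θ ^ n) + sphereSlice n y) =
      -(n + 1) * ∫ θ in (0 : ℝ)..Real.pi,
        -Real.sin (y * Real.cos θ) * Real.cos θ * Real.sin θ ^ n := by
  have key := intervalIntegral.integral_eq_sub_of_hasDerivAt (a := 0) (b := Real.pi)
    (f := fun θ => Real.sin θ ^ (n + 1) * Real.sin (y * Real.cos θ))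
    (f' := fun θ => y * (-(-Real.cos (y * Real.cos θ) * Real.cos θ ^ 2 * Real.sin θ ^ n) -
      Real.cos (y * Real.cos θ) * Real.sin θ ^ n) -
        (n + 1) * (-Real.sin (y * Real.cos θ) * Real.cos θ * Real.sin θ ^ n))
    (fun θ _ => by
      refine (((Real.hasDerivAt_sin θ).pow (n + 1)).mul
        (((Real.hasDerivAt_cos θ).const_mul y).sin)).congr_deriv ?_
      have := Real.sin_sq_add_cos_sq θ
      simp only [Pi.pow_apply, Nat.add_sub_cancel, Nat.cast_add, Nat.cast_one]
      linear_combination (-y * Real.cos (y * Real.cos θ) * Real.sin θ ^ n) * this)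
    (Continuous.intervalIntegrable (by fun_prop) _ _)
  rw [intervalIntegral.integral_sub, intervalIntegral.integral_const_mul,
    intervalIntegral.integral_const_mul, intervalIntegral.integral_sub,
    intervalIntegral.integral_neg] at key
  · simp only [Real.sin_pi, Real.sin_zero, ne_eq, Nat.succ_ne_zero, not_false_eq_true, zero_pow,
      zero_mul, sub_zero] at key
    rw [sphereSlice]
    linear_combination -key
  all_goals exact Continuous.intervalIntegrable (by fun_prop) _ _

lemma abs_sphereSlice_le (n : ℕ) (y : ℝ) : |sphereSlice n y| ≤ Real.pi := by
  have := intervalIntegral.norm_integral_le_of_norm_le_const (a := 0) (b := Real.pi) (C := 1)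
    (f := fun θ => Real.cos (y * Real.cos θ) * Real.sin θ ^ n) fun θ _ => by
      rw [norm_mul, norm_pow]
      exact mul_le_one₀ (Real.abs_cos_le_one _) (by positivity)
        (pow_le_one₀ (norm_nonneg _) (Real.abs_sin_le_one _))
  simpa [sphereSlice, abs_of_pos Real.pi_pos] using this

lemma continuous_sphereSlice (n : ℕ) : Continuous (sphereSlice n) :=
  continuous_iff_continuousAt.2 fun y => (hasDerivAt_sphereSlice n y).continuousAt

/-- The Liouville transform `u = y^{(n+1)/2} J` turns the equation of `J = sphereSlice n` into
`u'' = (q / y² - 1) u`, whence the decay of order `(n+1)/2` with its leading oscillations. -/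
lemma exists_norm_sphereSlice_sub_le (n : ℕ) :
    ∃ (c₁ c₂ : ℂ) (C : ℝ), 0 ≤ C ∧ ∀ y : ℝ, 1 ≤ y →
      ‖((y ^ (((n : ℝ) + 1) / 2) * sphereSlice n y : ℝ) : ℂ) -
        (c₁ * exp (I * y) + c₂ * exp (-(I * y)))‖ ≤ C / y := by
  set p : ℝ := ((n : ℝ) + 1) / 2 with hp
  set J1 : ℝ → ℝ := fun y => ∫ θ in (0 : ℝ)..Real.pi,
        -Real.sin (y * Real.cos θ) * Real.cos θ * Real.sin θ ^ n
  set J2 : ℝ → ℝ := fun y => ∫ θ in (0 : ℝ)..Real.pi,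
        -Real.cos (y * Real.cos θ) * Real.cos θ ^ 2 * Real.sin θ ^ n
  refine exists_norm_sub_exp_le_of_hasDerivAt (q := p * (p - 1))
    (v := fun y => p * y ^ (p - 1) * sphereSlice n y + y ^ p * J1 y)
    (fun y hy => ?_) (fun y hy => ?_)
  · exact (Real.hasDerivAt_rpow_const (Or.inl (by linarith))).mul (hasDerivAt_sphereSlice n y)
  · have hy0 : 0 < y := by linarith
    have h1 : HasDerivAt (fun y : ℝ => y ^ p) (p * y ^ (p - 1)) y :=
      Real.hasDerivAt_rpow_const (Or.inl hy0.ne')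
    have h2 : HasDerivAt (fun y : ℝ => y ^ (p - 1)) ((p - 1) * y ^ (p - 1 - 1)) y :=
      Real.hasDerivAt_rpow_const (Or.inl hy0.ne')
    have hJ2 : HasDerivAt J1 (J2 y) y := hasDerivAt_deriv_sphereSlice n y
    refine (((h2.const_mul p).mul (hasDerivAt_sphereSlice n y)).add
      (h1.mul hJ2)).congr_deriv ?_
    have e := sphereSlice_ode n y
    change y * (J2 y + sphereSlice n y) = -(n + 1) * J1 y at e
    rw [show (n : ℝ) + 1 = 2 * p by rw [hp]; ring] at e
    change p * ((p - 1) * y ^ (p - 1 - 1)) * sphereSlice n y + p * y ^ (p - 1) * J1 y +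
      (p * y ^ (p - 1) * J1 y + y ^ p * J2 y) = _
    rw [Real.rpow_sub_one hy0.ne', Real.rpow_sub_one hy0.ne']
    field_simp
    linear_combination y * e

lemma integral_sin_pow_mul_exp_eq_sphereSlice (m : ℕ) (y : ℝ) :
    ∫ θ in Ioo 0 Real.pi, ((Real.sin θ ^ m : ℝ) : ℂ) * exp (I * ((y * Real.cos θ : ℝ) : ℂ)) =
      sphereSlice m y := by
  -- The imaginary part is odd under `θ ↦ π - θ`.
  have hodd : ∫ θ in (0 : ℝ)..Real.pi, Real.sin (y * Real.cos θ) * Real.sin θ ^ m = 0 := by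
    have h := intervalIntegral.integral_comp_sub_left (a := 0) (b := Real.pi)
      (fun θ => Real.sin (y * Real.cos θ) * Real.sin θ ^ m) Real.pi
    simp only [Real.cos_pi_sub, Real.sin_pi_sub, mul_neg, Real.sin_neg, neg_mul, sub_self,
      sub_zero, intervalIntegral.integral_neg] at h
    linarith
  rw [← integral_Ioc_eq_integral_Ioo, ← intervalIntegral.integral_of_le Real.pi_pos.le]
  have e : ∀ θ : ℝ, ((Real.sin θ ^ m : ℝ) : ℂ) * exp (I * ((y * Real.cos θ : ℝ) : ℂ)) =
      ((Real.cos (y * Real.cos θ) * Real.sin θ ^ m : ℝ) : ℂ) +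
        I * ((Real.sin (y * Real.cos θ) * Real.sin θ ^ m : ℝ) : ℂ) := by
    intro θ
    rw [mul_comm I, exp_mul_I]
    push_cast
    ring
  simp only [e]
  rw [intervalIntegral.integral_add, intervalIntegral.integral_const_mul,
    intervalIntegral.integral_ofReal, intervalIntegral.integral_ofReal, hodd, sphereSlice]
  · simp
  all_goals exact Continuous.intervalIntegrable (by fun_prop) _ _

/-! ### Integrals of functions of `⟪x, ξ⟫` and `‖ξ‖` -/

open Module in
/-- The distribution of the norm under Haar measure. -/
lemma map_norm_addHaar {E : Type*} [NormedAddCommGroup E] [NormedSpace ℝ E] [Nontrivial E]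
    [FiniteDimensional ℝ E] [MeasurableSpace E] [BorelSpace E] (μ : Measure E)
    [μ.IsAddHaarMeasure] :
    μ.map norm = μ.toSphere univ •
      (volume.restrict (Ioi (0 : ℝ))).withDensity
        fun r => ENNReal.ofReal (r ^ (finrank ℝ E - 1)) := by
  refine Measure.ext_of_lintegral _ fun g hg => ?_
  rw [lintegral_map hg measurable_norm, lintegral_smul_measure,
    lintegral_withDensity_eq_lintegral_mul _ (by fun_prop) hg]
  calc ∫⁻ x, g ‖x‖ ∂μ = ∫⁻ x : ({(0)}ᶜ : Set E), g ‖x.1‖ ∂(μ.comap (↑)) := by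
        rw [lintegral_subtype_comap (measurableSet_singleton _).compl fun x => g ‖x‖,
          restrict_compl_singleton]
    _ = ∫⁻ x, g x.2 ∂μ.toSphere.prod (.volumeIoiPow (finrank ℝ E - 1)) := by
        simpa using μ.measurePreserving_homeomorphUnitSphereProd.lintegral_comp_emb
          (Homeomorph.measurableEmbedding _)
          (fun y : Metric.sphere (0 : E) 1 × Ioi (0 : ℝ) => g (y.2 : ℝ))
    _ = μ.toSphere univ • ∫⁻ x : Ioi (0 : ℝ), g x ∂.volumeIoiPow (finrank ℝ E - 1) := by
        rw [lintegral_prod _ (by fun_prop)]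
        simp only [lintegral_const, smul_eq_mul]
        exact mul_comm _ _
    _ = _ := by
        rw [Measure.volumeIoiPow, lintegral_withDensity_eq_lintegral_mul _ (by fun_prop)
          (by fun_prop)]
        congr 1
        exact lintegral_subtype_comap measurableSet_Ioi
          ((fun r => ENNReal.ofReal (r ^ (finrank ℝ E - 1))) * g)

/-- Every vector is a multiple of the first vector of some orthonormal basis. -/
lemma exists_orthonormalBasis_smul_eq {m : ℕ} (x : EuclideanSpace ℝ (Fin (m + 1))) :
    ∃ b : OrthonormalBasis (Fin (m + 1)) ℝ (EuclideanSpace ℝ (Fin (m + 1))),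
      x = ‖x‖ • b 0 := by
  by_cases hx : x = 0
  · exact ⟨EuclideanSpace.basisFun _ ℝ, by simp [hx]⟩
  have hx' : ‖x‖ ≠ 0 := norm_ne_zero_iff.2 hx
  obtain ⟨b, hb⟩ := Orthonormal.exists_orthonormalBasis_extension_of_card_eq (𝕜 := ℝ)
    (E := EuclideanSpace ℝ (Fin (m + 1))) (ι := Fin (m + 1)) (by simp)
    (v := fun _ => ‖x‖⁻¹ • x) (s := {0})
    ⟨fun i => by simp [norm_smul, hx'], fun i j hij => absurd (Subsingleton.elim i j) hij⟩
  refine ⟨b, ?_⟩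
  rw [hb 0 rfl, smul_inv_smul₀ hx']

/-- Splitting off the first coordinate of a Euclidean space. -/
lemma measurePreserving_fst_norm_tail (m : ℕ) :
    MeasurePreserving (fun ξ : EuclideanSpace ℝ (Fin (m + 1)) =>
        (ξ 0, ‖WithLp.toLp 2 fun i : Fin m => ξ i.succ‖)) volume
      (volume.prod ((volume : Measure (EuclideanSpace ℝ (Fin m))).map norm)) := by
  have h1 := PiLp.volume_preserving_ofLp (Fin (m + 1))
  have h2 := volume_preserving_piFinSuccAbove (fun _ : Fin (m + 1) => ℝ) 0
  have h3 : MeasurePreserving (fun η : Fin m → ℝ => ‖WithLp.toLp 2 η‖) volume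
      ((volume : Measure (EuclideanSpace ℝ (Fin m))).map norm) :=
    (measurable_norm.measurePreserving _).comp (PiLp.volume_preserving_toLp (Fin m))
  have : SFinite ((volume : Measure (EuclideanSpace ℝ (Fin m))).map norm) := inferInstance
  have h4 := ((MeasurePreserving.id (volume : Measure ℝ)).prod h3).comp (h2.comp h1)
  exact h4

/-- Integration in polar coordinates of the half-plane. -/
lemma integral_prod_Ioi_eq_polar (g : ℝ → ℝ → ℂ) :
    ∫ p in univ ×ˢ Ioi (0 : ℝ), g p.1 p.2 =
      ∫ q in Ioi (0 : ℝ) ×ˢ Ioo 0 Real.pi,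
        q.1 • g (q.1 * Real.cos q.2) (q.1 * Real.sin q.2) := by
  have hm : MeasurableSet (univ ×ˢ Ioi (0 : ℝ) : Set (ℝ × ℝ)) :=
    MeasurableSet.univ.prod measurableSet_Ioi
  have hm' : MeasurableSet (Ioi (0 : ℝ) ×ˢ Ioo 0 Real.pi : Set (ℝ × ℝ)) :=
    measurableSet_Ioi.prod measurableSet_Ioo
  have hsub : Ioi (0 : ℝ) ×ˢ Ioo 0 Real.pi ⊆ polarCoord.target := by
    rintro ⟨r, θ⟩ ⟨hr, hθ⟩
    exact ⟨hr, by linarith [Real.pi_pos, hθ.1], hθ.2⟩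
  rw [← integral_indicator hm, ← integral_comp_polarCoord_symm,
    setIntegral_eq_of_subset_of_forall_sdiff_eq_zero polarCoord.open_target.measurableSet hsub]
  · refine setIntegral_congr_fun hm' fun q hq => ?_
    have hs : 0 < q.1 * Real.sin q.2 :=
      mul_pos hq.1 (Real.sin_pos_of_pos_of_lt_pi hq.2.1 hq.2.2)
    simp only [polarCoord_symm_apply]
    rw [indicator_of_mem]
    exact ⟨mem_univ _, hs⟩
  · rintro ⟨r, θ⟩ ⟨⟨hr, hθ⟩, hq⟩
    have hr : 0 < r := hr
    have hθ0 : θ ≤ 0 := by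
      by_contra h
      exact hq ⟨hr, not_le.1 h, hθ.2⟩
    simp only [polarCoord_symm_apply]
    rw [indicator_of_notMem, smul_zero]
    rintro ⟨-, h⟩
    have h1 := Real.sin_nonpos_of_nonpos_of_neg_pi_le hθ0 hθ.1.le
    exact absurd h (not_lt.2 (mul_nonpos_of_nonneg_of_nonpos hr.le h1))

/-- Polar coordinates adapted to functions of `⟪x, ξ⟫` and `‖ξ‖`: here `r = ‖ξ‖` and `θ` is the
angle between `x` and `ξ`. -/
lemma exists_integral_inner_norm_eq (m : ℕ) :
    ∃ c : ℝ, 0 ≤ c ∧ ∀ (x : EuclideanSpace ℝ (Fin (m + 2))) (f : ℝ → ℝ → ℂ),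
      Measurable (fun p : ℝ × ℝ => f p.1 p.2) →
      ∫ ξ : EuclideanSpace ℝ (Fin (m + 2)), f (inner ℝ x ξ) ‖ξ‖ =
        c * ∫ q in Ioi (0 : ℝ) ×ˢ Ioo 0 Real.pi,
          ((q.1 ^ (m + 1) * Real.sin q.2 ^ m : ℝ) : ℂ) *
            f (‖x‖ * q.1 * Real.cos q.2) q.1 := by
  set S := (volume : Measure (EuclideanSpace ℝ (Fin (m + 1)))).toSphere univ
  have hS : S ≠ ⊤ := measure_ne_top _ _
  refine ⟨S.toReal, ENNReal.toReal_nonneg, fun x f hf => ?_⟩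
  obtain ⟨b, hb⟩ := exists_orthonormalBasis_smul_eq x
  set h : ℝ × ℝ → ℂ := fun p => f (‖x‖ * p.1) (Real.sqrt (p.1 ^ 2 + p.2 ^ 2)) with hh
  have hhm : Measurable h := hf.comp (by fun_prop : Measurable fun p : ℝ × ℝ =>
    (‖x‖ * p.1, Real.sqrt (p.1 ^ 2 + p.2 ^ 2)))
  have hmp := (measurePreserving_fst_norm_tail (m + 1)).comp b.measurePreserving_repr
  have e1 : ∀ ξ : EuclideanSpace ℝ (Fin (m + 2)), f (inner ℝ x ξ) ‖ξ‖ =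
      h (b.repr ξ 0, ‖WithLp.toLp 2 fun i : Fin (m + 1) => b.repr ξ i.succ‖) := by
    intro ξ
    simp only [hh]
    congr 1
    · conv_lhs => rw [hb]
      rw [real_inner_smul_left, b.repr_apply_apply]
    · rw [← b.repr.norm_map ξ, EuclideanSpace.real_norm_sq_eq, ← Fin.sum_univ_succ
        (fun i => b.repr ξ i ^ 2), ← EuclideanSpace.real_norm_sq_eq,
        Real.sqrt_sq (norm_nonneg _)]
  have hν : (volume : Measure ℝ).prod
      ((volume : Measure (EuclideanSpace ℝ (Fin (m + 1)))).map norm) =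
      S • ((volume.restrict (univ ×ˢ Ioi (0 : ℝ)) : Measure (ℝ × ℝ)).withDensity
        fun p => ((Real.toNNReal (p.2 ^ m) : NNReal) : ENNReal)) := by
    rw [map_norm_addHaar, Measure.prod_smul_right, prod_withDensity_right (by fun_prop),
      Measure.volume_eq_prod, ← Measure.prod_restrict, Measure.restrict_univ]
    simp only [finrank_euclideanSpace, Fintype.card_fin, Nat.add_sub_cancel]
    rfl
  calc ∫ ξ : EuclideanSpace ℝ (Fin (m + 2)), f (inner ℝ x ξ) ‖ξ‖
      = ∫ p, h p ∂((volume : Measure ℝ).prod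
          ((volume : Measure (EuclideanSpace ℝ (Fin (m + 1)))).map norm)) := by
        rw [← hmp.map_eq, integral_map hmp.measurable.aemeasurable
          hhm.aestronglyMeasurable]
        exact integral_congr_ae (Eventually.of_forall e1)
    _ = S.toReal * ∫ p in univ ×ˢ Ioi (0 : ℝ), Real.toNNReal (p.2 ^ m) • h p := by
        rw [hν, integral_smul_measure, integral_withDensity_eq_integral_smul (by fun_prop),
          real_smul]
    _ = _ := by
        rw [integral_prod_Ioi_eq_polar fun a s => Real.toNNReal (s ^ m) • h (a, s)]
        congr 1
        refine setIntegral_congr_fun (measurableSet_Ioi.prod measurableSet_Ioo) fun q hq => ?_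
        have hr : 0 < q.1 := hq.1
        have hs : 0 < Real.sin q.2 := Real.sin_pos_of_pos_of_lt_pi hq.2.1 hq.2.2
        simp only [hh]
        rw [show (q.1 * Real.cos q.2) ^ 2 + (q.1 * Real.sin q.2) ^ 2 = q.1 ^ 2 by
          linear_combination q.1 ^ 2 * Real.sin_sq_add_cos_sq q.2, Real.sqrt_sq hr.le,
          NNReal.smul_def, Real.coe_toNNReal _ (by positivity), real_smul, real_smul]
        push_cast
        ring_nf

/-! ### Reduction of the wave integral to one dimension -/

lemma oscAmp_add_mul (χ : ℝ → ℂ) (z : ℂ) (s s' r : ℝ) :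
    oscAmp χ z (s + s') r = oscAmp χ z s r * exp (I * ((s' * r : ℝ) : ℂ)) := by
  rw [oscAmp, oscAmp, mul_assoc _ (exp _), ← Complex.exp_add]
  push_cast
  ring_nf

lemma measurable_uncurry_oscAmp {χ : ℝ → ℂ} (hχ : Continuous χ) (z : ℂ) (t ρ : ℝ) :
    Measurable fun q : ℝ × ℝ => oscAmp χ z (t + ρ * Real.cos q.2) q.1 := by
  have := hχ.measurable
  unfold oscAmp
  fun_prop

lemma integrable_sin_pow_mul_oscAmp {χ : ℝ → ℂ} (hχ : Continuous χ)
    (hsupp : tsupport χ ⊆ Ioo (-1) 1) {z : ℂ} (hz : -1 < z.re) (m : ℕ) (t ρ : ℝ) :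
    Integrable (fun q : ℝ × ℝ =>
      ((Real.sin q.2 ^ m : ℝ) : ℂ) * oscAmp χ z (t + ρ * Real.cos q.2) q.1)
      ((volume.restrict (Ioi 0)).prod (volume.restrict (Ioo 0 Real.pi))) := by
  have h0 : Integrable (fun q : ℝ × ℝ => oscAmp χ z 0 q.1 * (1 : ℂ))
      ((volume.restrict (Ioi 0)).prod (volume.restrict (Ioo 0 Real.pi))) :=
    Integrable.mul_prod (integrableOn_Ioi_zero_oscAmp hχ hsupp hz 0) (integrable_const (1 : ℂ))
  refine h0.mono ?_ (Eventually.of_forall fun q => ?_)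
  · exact ((by fun_prop : Measurable fun q : ℝ × ℝ => ((Real.sin q.2 ^ m : ℝ) : ℂ)).mul
      (measurable_uncurry_oscAmp hχ z t ρ)).aestronglyMeasurable
  · have e : ∀ s, ‖oscAmp χ z s q.1‖ = ‖(q.1 : ℂ) ^ z * χ q.1‖ := fun s => by
      rw [oscAmp, norm_mul, norm_exp_I_mul_mul, mul_one]
    rw [mul_one, norm_mul, e, e, norm_real, norm_pow]
    exact mul_le_of_le_one_left (norm_nonneg _)
      (pow_le_one₀ (norm_nonneg _) (Real.abs_sin_le_one _))

/-- The wave integral as an integral over the radius `r` and the angle `θ` between `x` and `ξ`. -/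
lemma exists_waveOsc_eq (m : ℕ) {χ : ℝ → ℂ} (hχ : Continuous χ) :
    ∃ c : ℝ, 0 ≤ c ∧ ∀ (κ : ℝ) (x : EuclideanSpace ℝ (Fin (m + 2))) (t : ℝ),
      waveOsc (m + 2) χ κ x t = c * ∫ q, ((Real.sin q.2 ^ m : ℝ) : ℂ) *
        oscAmp χ ((((m : ℝ) - 1) / 2 : ℝ) + I * κ) (t + ‖x‖ * Real.cos q.2) q.1
        ∂((volume.restrict (Ioi (0 : ℝ))).prod (volume.restrict (Ioo 0 Real.pi))) := by
  obtain ⟨c, hc, h⟩ := exists_integral_inner_norm_eq m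
  refine ⟨c, hc, fun κ x t => ?_⟩
  have hχm := hχ.measurable
  have h' := h x (fun a r => exp (I * ((a + t * r : ℝ) : ℂ)) *
    (r : ℂ) ^ (-(((m + 2 : ℕ) : ℂ) + 1) / 2 + I * (κ : ℂ)) * χ r) (by fun_prop)
  rw [waveOsc]
  refine h'.trans ?_
  rw [Measure.prod_restrict, ← Measure.volume_eq_prod]
  congr 1
  refine setIntegral_congr_fun (measurableSet_Ioi.prod measurableSet_Ioo) fun q hq => ?_
  have hr : 0 < q.1 := hq.1
  have hr0 : (q.1 : ℂ) ≠ 0 := by exact_mod_cast hr.ne'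
  have e1 : (q.1 : ℂ) ^ ((((m : ℝ) - 1) / 2 : ℝ) + I * κ) =
      (q.1 : ℂ) ^ (m + 1) * (q.1 : ℂ) ^ (-(((m + 2 : ℕ) : ℂ) + 1) / 2 + I * (κ : ℂ)) := by
    rw [← cpow_natCast, ← cpow_add _ _ hr0]
    congr 1
    push_cast
    ring
  simp only [oscAmp]
  rw [e1]
  push_cast
  ring_nf

/-! ### The two regimes -/

/-- Well inside the light cone the phase is non-stationary in `r` for every angle `θ`. -/
lemma exists_norm_waveOsc_le_of_two_mul_norm_le (m : ℕ) {χ : ℝ → ℂ} (hχ : ContDiff ℝ ∞ χ)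
    (hsupp : tsupport χ ⊆ Ioo (-1) 1) :
    ∃ (C : ℝ) (N : ℕ), 0 ≤ C ∧ ∀ (κ t ρ : ℝ), t ≠ 0 → 0 ≤ ρ → 2 * ρ ≤ |t| →
      ‖∫ q, ((Real.sin q.2 ^ m : ℝ) : ℂ) *
        oscAmp χ ((((m : ℝ) - 1) / 2 : ℝ) + I * κ) (t + ρ * Real.cos q.2) q.1
        ∂((volume.restrict (Ioi (0 : ℝ))).prod (volume.restrict (Ioo 0 Real.pi)))‖ ≤
      C * (1 + |κ|) ^ N * |t| ^ (-(((m : ℝ) + 1) / 2)) := by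
  set a : ℝ := ((m : ℝ) - 1) / 2 with ha
  have hm : (0 : ℝ) ≤ m := Nat.cast_nonneg m
  have ha1 : -1 < a := by rw [ha]; linarith
  obtain ⟨C, N, hC, h⟩ := exists_norm_integral_Ioi_zero_oscAmp_le ha1 hχ hsupp
  rw [show ((m : ℝ) + 1) / 2 = a + 1 by rw [ha]; ring]
  refine ⟨C * 2 ^ (a + 1) * Real.pi, N, by positivity, fun κ t ρ ht hρ hρt => ?_⟩
  have ht0 : 0 < |t| := abs_pos.2 ht
  rw [integral_prod_symm _
    (integrable_sin_pow_mul_oscAmp hχ.continuous hsupp (by simpa using ha1) m t ρ)]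
  have hb : ∀ θ : ℝ, ‖∫ r in Ioi (0 : ℝ), ((Real.sin θ ^ m : ℝ) : ℂ) *
      oscAmp χ (a + I * κ) (t + ρ * Real.cos θ) r‖ ≤
        C * 2 ^ (a + 1) * (1 + |κ|) ^ N * |t| ^ (-(a + 1)) := by
    intro θ
    have hs : |t| / 2 ≤ |t + ρ * Real.cos θ| := by
      have h1 : |ρ * Real.cos θ| ≤ ρ := by
        rw [abs_mul, abs_of_nonneg hρ]
        exact mul_le_of_le_one_right hρ (Real.abs_cos_le_one θ)
      have h2 := abs_sub_abs_le_abs_sub t (-(ρ * Real.cos θ))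
      rw [abs_neg, sub_neg_eq_add] at h2
      linarith
    have hs0 : 0 < |t + ρ * Real.cos θ| := by linarith
    rw [integral_const_mul, norm_mul, norm_real, norm_pow]
    calc _ ≤ 1 * (C * (1 + |κ|) ^ N * |t + ρ * Real.cos θ| ^ (-(a + 1))) := by
          gcongr
          · exact pow_le_one₀ (norm_nonneg _) (Real.abs_sin_le_one _)
          · exact h κ _ (abs_pos.1 hs0)
      _ ≤ 1 * (C * (1 + |κ|) ^ N * (|t| / 2) ^ (-(a + 1))) := by
          gcongr 1 * (C * (1 + |κ|) ^ N * ?_)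
          exact Real.rpow_le_rpow_of_nonpos (by positivity) hs (by linarith)
      _ = _ := by
          rw [Real.div_rpow ht0.le two_pos.le, Real.rpow_neg two_pos.le, div_inv_eq_mul]
          ring
  have := norm_setIntegral_le_of_norm_le_const (μ := volume) (s := Ioo 0 Real.pi)
    (by simp) (fun θ _ => hb θ)
  refine this.trans (le_of_eq ?_)
  rw [Real.volume_real_Ioo_of_le Real.pi_pos.le]
  ring

/-- The estimate used for `2‖x‖ > |t|`, where `|t| = ‖x‖` is allowed: once the decay of the
slice integral has been extracted, a logarithmically divergent integral remains, which the factor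
`κ` makes bounded. -/
lemma exists_norm_mul_integral_oscAmp_mul_sphereSlice_le (m : ℕ) {χ : ℝ → ℂ}
    (hχ : ContDiff ℝ ∞ χ) (hsupp : tsupport χ ⊆ Ioo (-1) 1) :
    ∃ (C : ℝ) (N : ℕ), 0 ≤ C ∧ ∀ (κ t ρ : ℝ), 0 < ρ →
      ‖(κ : ℂ) * ∫ r in Ioi (0 : ℝ), oscAmp χ ((((m : ℝ) - 1) / 2 : ℝ) + I * κ) t r *
        sphereSlice m (ρ * r)‖ ≤ C * (1 + |κ|) ^ N * ρ ^ (-(((m : ℝ) + 1) / 2)) := by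
  obtain ⟨c₁, c₂, C₀, hC₀, hJ⟩ := exists_norm_sphereSlice_sub_le m
  set a : ℝ := ((m : ℝ) - 1) / 2 with ha
  have hm : (0 : ℝ) ≤ m := Nat.cast_nonneg m
  have ha1 : -1 < a := by rw [ha]; linarith
  have ha1' : 0 < a + 1 := by linarith
  rw [show ((m : ℝ) + 1) / 2 = a + 1 by rw [ha]; ring] at hJ ⊢
  obtain ⟨M, hM0, hM⟩ := exists_norm_le_of_tsupport_subset hχ.continuous hsupp
  obtain ⟨C, N, hC, h⟩ := exists_norm_mul_integral_Ioi_oscAmp_le hχ hsupp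
  refine ⟨Real.pi * M / (a + 1) + (‖c₁‖ * C + ‖c₂‖ * C + M * C₀), N + 1, by positivity,
    fun κ t ρ hρ => ?_⟩
  set E : ℝ → ℂ := fun y => ((y ^ (a + 1) * sphereSlice m y : ℝ) : ℂ) -
    (c₁ * exp (I * y) + c₂ * exp (-(I * y))) with hE
  have hEm : Measurable E := by
    have := (continuous_sphereSlice m).measurable
    fun_prop
  set F : ℝ → ℂ := fun r => oscAmp χ (a + I * κ) t r * sphereSlice m (ρ * r) with hF
  set δ : ℝ := ρ⁻¹ with hδdef
  have hδ : 0 < δ := inv_pos.2 hρ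
  have hK1 : 1 ≤ 1 + |κ| := by have := abs_nonneg κ; linarith
  have hFi : IntegrableOn F (Ioi 0) := by
    refine (integrableOn_Ioi_zero_oscAmp hχ.continuous hsupp (z := a + I * κ)
      (by simpa using ha1) t).mul_bdd (c := Real.pi) ?_ ?_
    · exact (continuous_ofReal.comp ((continuous_sphereSlice m).comp
        (continuous_const.mul continuous_id))).aestronglyMeasurable
    · refine Eventually.of_forall fun r => ?_
      rw [norm_real]
      exact abs_sphereSlice_le m _
  have hδ' : δ ^ (a + 1) = ρ ^ (-(a + 1)) := by
    rw [hδdef, Real.inv_rpow hρ.le, Real.rpow_neg hρ.le]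
  -- The head, where the slice integral is merely bounded.
  have head : ‖∫ r in Ioc 0 δ, F r‖ ≤ Real.pi * M / (a + 1) * ρ ^ (-(a + 1)) := by
    have hi : IntegrableOn (fun r : ℝ => r ^ a) (Ioc 0 δ) :=
      (intervalIntegral.intervalIntegrable_rpow' ha1).1
    calc ‖∫ r in Ioc 0 δ, F r‖ ≤ ∫ r in Ioc 0 δ, r ^ a * (M * Real.pi) := by
          refine norm_integral_le_of_norm_le (hi.mul_const _) ?_
          filter_upwards [ae_restrict_mem measurableSet_Ioc] with r hr
          have hr0 := hr.1
          rw [hF, norm_mul, norm_oscAmp _ _ _ hr0, norm_real, mul_assoc]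
          have h1 := hM r
          have h2 := abs_sphereSlice_le m (ρ * r)
          have h3 : ((a : ℂ) + I * κ).re = a := by simp
          rw [h3, Real.norm_eq_abs]
          gcongr
      _ = _ := by
          rw [integral_mul_const, ← intervalIntegral.integral_of_le hδ.le,
            integral_rpow (Or.inl ha1), Real.zero_rpow ha1'.ne', hδ']
          ring
  -- The tail, where the slice integral is replaced by its asymptotics.
  have hsplit : ∀ r ∈ Ioi δ, F r = ((ρ ^ (-(a + 1)) : ℝ) : ℂ) *
      (c₁ * oscAmp χ (((-1 : ℝ) : ℂ) + I * κ) (t + ρ) r +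
        c₂ * oscAmp χ (((-1 : ℝ) : ℂ) + I * κ) (t + -ρ) r +
        oscAmp χ (((-1 : ℝ) : ℂ) + I * κ) t r * E (ρ * r)) := by
    intro r hr
    have hr0 : 0 < r := hδ.trans hr
    have hrc : (r : ℂ) ≠ 0 := by exact_mod_cast hr0.ne'
    have e1 : oscAmp χ (a + I * κ) t r =
        ((r ^ (a + 1) : ℝ) : ℂ) * oscAmp χ (((-1 : ℝ) : ℂ) + I * κ) t r := by
      rw [oscAmp, oscAmp, ofReal_cpow hr0.le, show (a : ℂ) + I * κ =
        ((a + 1 : ℝ) : ℂ) + (((-1 : ℝ) : ℂ) + I * κ) by push_cast; ring, cpow_add _ _ hrc]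
      ring
    have e2 : ρ ^ (-(a + 1)) * (ρ * r) ^ (a + 1) = r ^ (a + 1) := by
      rw [Real.mul_rpow hρ.le hr0.le, Real.rpow_neg hρ.le,
        inv_mul_cancel_left₀ (Real.rpow_pos_of_pos hρ _).ne']
    have e3 : I * ((-ρ * r : ℝ) : ℂ) = -(I * ((ρ * r : ℝ) : ℂ)) := by push_cast; ring
    rw [oscAmp_add_mul, oscAmp_add_mul, e3]
    simp only [hF, hE]
    rw [e1, ← e2]
    push_cast
    ring
  have hErr : ∀ r ∈ Ioi δ, ‖oscAmp χ (((-1 : ℝ) : ℂ) + I * κ) t r * E (ρ * r)‖ ≤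
      M * C₀ * δ * r ^ (-2 : ℝ) := by
    intro r hr
    have hr0 : 0 < r := hδ.trans hr
    have hy : 1 ≤ ρ * r := by
      have : δ < r := hr
      rw [hδdef, inv_lt_iff_one_lt_mul₀ hρ] at this
      linarith
    have h1 : ‖E (ρ * r)‖ ≤ C₀ / (ρ * r) := hJ _ hy
    have h3 : (((-1 : ℝ) : ℂ) + I * κ).re = -1 := by simp
    rw [norm_mul, norm_oscAmp _ _ _ hr0, h3]
    calc r ^ (-1 : ℝ) * ‖χ r‖ * ‖E (ρ * r)‖ ≤ r ^ (-1 : ℝ) * M * (C₀ / (ρ * r)) := by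
          have := hM r
          gcongr
      _ = _ := by
          rw [show (-2 : ℝ) = -1 + -1 by norm_num, Real.rpow_add hr0, Real.rpow_neg_one, hδdef]
          field_simp
  have hdom : IntegrableOn (fun r : ℝ => M * C₀ * δ * r ^ (-2 : ℝ)) (Ioi δ) :=
    (integrableOn_Ioi_rpow_of_lt (by norm_num) hδ).const_mul _
  have hErrM : Measurable fun r =>
      oscAmp χ (((-1 : ℝ) : ℂ) + I * κ) t r * E (ρ * r) :=
    (measurable_oscAmp hχ.continuous _ t).mul (hEm.comp (measurable_const_mul ρ))
  have hErrI : IntegrableOn (fun r =>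
      oscAmp χ (((-1 : ℝ) : ℂ) + I * κ) t r * E (ρ * r)) (Ioi δ) := by
    refine hdom.mono' hErrM.aestronglyMeasurable ?_
    filter_upwards [ae_restrict_mem measurableSet_Ioi] with r hr using hErr r hr
  have hErrN : ‖∫ r in Ioi δ, oscAmp χ (((-1 : ℝ) : ℂ) + I * κ) t r * E (ρ * r)‖ ≤ M * C₀ := by
    refine (norm_integral_le_of_norm_le hdom ?_).trans (le_of_eq ?_)
    · filter_upwards [ae_restrict_mem measurableSet_Ioi] with r hr using hErr r hr
    · rw [integral_const_mul, integral_Ioi_rpow_of_lt (by norm_num) hδ,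
        show (-2 : ℝ) + 1 = -1 by norm_num, Real.rpow_neg_one]
      field_simp
  have i1 := (integrableOn_oscAmp hχ.continuous hsupp
    (((-1 : ℝ) : ℂ) + I * κ) (t + ρ) hδ).const_mul c₁
  have i2 := (integrableOn_oscAmp hχ.continuous hsupp
    (((-1 : ℝ) : ℂ) + I * κ) (t + -ρ) hδ).const_mul c₂
  have i12 : IntegrableOn (fun r => c₁ * oscAmp χ (((-1 : ℝ) : ℂ) + I * κ) (t + ρ) r +
        c₂ * oscAmp χ (((-1 : ℝ) : ℂ) + I * κ) (t + -ρ) r) (Ioi δ) := i1.add i2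
  have b1 := h κ (t + ρ) δ hδ
  have b2 := h κ (t + -ρ) δ hδ
  have hκ : |κ| ≤ 1 + |κ| := by linarith
  have p0 : |κ| ≤ (1 + |κ|) ^ (N + 1) := hκ.trans (le_self_pow₀ hK1 (Nat.succ_ne_zero N))
  have p1 : (1 + |κ|) ^ N ≤ (1 + |κ|) ^ (N + 1) := pow_le_pow_right₀ hK1 (Nat.le_succ N)
  set P := (1 + |κ|) ^ (N + 1)
  have tail : ‖(κ : ℂ) * ∫ r in Ioi δ, F r‖ ≤
      ρ ^ (-(a + 1)) * ((‖c₁‖ * C + ‖c₂‖ * C + M * C₀) * P) := by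
    rw [setIntegral_congr_fun measurableSet_Ioi hsplit, integral_const_mul,
      integral_add i12 hErrI, integral_add i1 i2, integral_const_mul, integral_const_mul,
      mul_left_comm, norm_mul, norm_real, Real.norm_of_nonneg (Real.rpow_nonneg hρ.le _)]
    gcongr
    rw [mul_add, mul_add, mul_left_comm _ c₁, mul_left_comm _ c₂]
    refine (norm_add_le _ _).trans ((add_le_add_left (norm_add_le _ _) _).trans ?_)
    rw [norm_mul c₁, norm_mul c₂, norm_mul (κ : ℂ) (∫ r in Ioi δ, _ * E (ρ * r)), norm_real,
      Real.norm_eq_abs]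
    calc _ ≤ ‖c₁‖ * (C * (1 + |κ|) ^ N) + ‖c₂‖ * (C * (1 + |κ|) ^ N) + |κ| * (M * C₀) := by
          gcongr
      _ ≤ ‖c₁‖ * (C * P) + ‖c₂‖ * (C * P) + P * (M * C₀) := by gcongr
      _ = _ := by ring
  rw [← Ioc_union_Ioi_eq_Ioi hδ.le, setIntegral_union (Ioc_disjoint_Ioi le_rfl) measurableSet_Ioi
    (hFi.mono_set Ioc_subset_Ioi_self) (hFi.mono_set (Ioi_subset_Ioi hδ.le)), mul_add]
  refine (norm_add_le _ _).trans ?_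
  rw [norm_mul (κ : ℂ) (∫ r in Ioc 0 δ, F r), norm_real, Real.norm_eq_abs]
  calc _ ≤ P * (Real.pi * M / (a + 1) * ρ ^ (-(a + 1))) +
        ρ ^ (-(a + 1)) * ((‖c₁‖ * C + ‖c₂‖ * C + M * C₀) * P) := by gcongr
    _ = _ := by ring

/-! ### The dispersive estimate -/

lemma integrable_waveIntegrand {d : ℕ} (hd : 2 ≤ d) {χ : ℝ → ℂ} (hχ : Continuous χ)
    (hsupp : tsupport χ ⊆ Ioo (-1) 1) (κ : ℝ) (x : EuclideanSpace ℝ (Fin d)) (t : ℝ) :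
    Integrable (waveIntegrand d χ κ x t) volume := by
  have hd' : (2 : ℝ) ≤ d := by exact_mod_cast hd
  have : Nontrivial (EuclideanSpace ℝ (Fin d)) := by
    have : Nonempty (Fin d) := ⟨⟨0, by omega⟩⟩
    infer_instance
  have hrad : Integrable
      (fun ξ : EuclideanSpace ℝ (Fin d) => ‖ξ‖ ^ (-((d : ℝ) + 1) / 2) * ‖χ ‖ξ‖‖) volume := by
    refine (integrable_fun_norm_addHaar volume
      (f := fun r => r ^ (-((d : ℝ) + 1) / 2) * ‖χ r‖)).2 ?_
    have h := (integrableOn_Ioi_zero_oscAmp hχ hsupp (z := ((((d : ℝ) - 3) / 2 : ℝ) : ℂ))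
      (by rw [ofReal_re]; linarith) 0).norm
    refine IntegrableOn.congr_fun h (fun r hr => ?_) measurableSet_Ioi
    have hr0 : 0 < r := hr
    simp only [norm_oscAmp _ _ _ hr0, ofReal_re, finrank_euclideanSpace, Fintype.card_fin,
      smul_eq_mul]
    rw [← Real.rpow_natCast, ← mul_assoc, ← Real.rpow_add hr0, Nat.cast_sub (by omega)]
    congr 2
    push_cast
    ring
  refine hrad.mono' ?_ (Eventually.of_forall fun ξ => le_of_eq ?_)
  · have := hχ.measurable
    unfold waveIntegrand
    exact Measurable.aestronglyMeasurable (by fun_prop)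
  · have hre : (-((d : ℂ) + 1) / 2 + I * (κ : ℂ)).re = -((d : ℝ) + 1) / 2 := by
      rw [show -((d : ℂ) + 1) / 2 = ((-((d : ℝ) + 1) / 2 : ℝ) : ℂ) by push_cast; ring]
      simp
    rw [waveIntegrand, norm_mul, norm_mul, mul_comm I, norm_exp_ofReal_mul_I, one_mul,
      norm_cpow_eq_rpow_re_of_nonneg (norm_nonneg ξ) (by rw [hre]; linarith), hre]

theorem proposition3p1 (d : ℕ) (hd : 2 ≤ d) (χ : ℝ → ℂ) (hχ : IsCutoff χ) :
    (∀ (κ : ℝ) (x : EuclideanSpace ℝ (Fin d)) (t : ℝ),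
      Integrable (waveIntegrand d χ κ x t) volume) ∧
    ∃ C N : ℝ, 0 < N ∧
      ∀ (κ : ℝ) (x : EuclideanSpace ℝ (Fin d)) (t : ℝ), t ≠ 0 →
        ‖(κ : ℂ) * waveOsc d χ κ x t‖ ≤
          C * (1 + |κ|) ^ N * |t| ^ (-((d : ℝ) - 1) / 2) := by
  have hcd := hχ.smooth
  have hsupp := hχ.tsupport_subset
  refine ⟨integrable_waveIntegrand hd hcd.continuous hsupp, ?_⟩
  obtain ⟨m, rfl⟩ := Nat.exists_eq_add_of_le' hd
  obtain ⟨c, hc, hW⟩ := exists_waveOsc_eq m hcd.continuous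
  obtain ⟨C₁, N₁, hC₁, h₁⟩ := exists_norm_waveOsc_le_of_two_mul_norm_le m hcd hsupp
  obtain ⟨C₂, N₂, hC₂, h₂⟩ := exists_norm_mul_integral_oscAmp_mul_sphereSlice_le m hcd hsupp
  set p : ℝ := ((m : ℝ) + 1) / 2 with hp
  have hm : (0 : ℝ) ≤ m := Nat.cast_nonneg m
  have hp0 : 0 < p := by rw [hp]; linarith
  refine ⟨c * (C₁ + C₂ * 2 ^ p), ((N₁ + N₂ + 1 : ℕ) : ℝ), by positivity, fun κ x t ht => ?_⟩
  have ht0 : 0 < |t| := abs_pos.2 ht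
  rw [Real.rpow_natCast, show -(((m + 2 : ℕ) : ℝ) - 1) / 2 = -p by push_cast; rw [hp]; ring,
    hW, mul_left_comm, norm_mul, norm_real, Real.norm_of_nonneg hc, mul_assoc c, mul_assoc c]
  refine mul_le_mul_of_nonneg_left ?_ hc
  have hK1 : 1 ≤ 1 + |κ| := by have := abs_nonneg κ; linarith
  have hT : 0 < |t| ^ (-p) := Real.rpow_pos_of_pos ht0 _
  have hP : 0 ≤ (1 + |κ|) ^ (N₁ + N₂ + 1) := by positivity
  rcases le_or_gt (2 * ‖x‖) |t| with hx | hx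
  · rw [norm_mul, norm_real, Real.norm_eq_abs]
    calc _ ≤ (1 + |κ|) * (C₁ * (1 + |κ|) ^ N₁ * |t| ^ (-p)) := by
          gcongr
          · linarith
          · exact h₁ κ t ‖x‖ ht (norm_nonneg x) hx
      _ = C₁ * (1 + |κ|) ^ (N₁ + 1) * |t| ^ (-p) := by ring
      _ ≤ (C₁ + C₂ * 2 ^ p) * (1 + |κ|) ^ (N₁ + N₂ + 1) * |t| ^ (-p) := by
          gcongr ?_ * ?_ * _
          · exact le_add_of_nonneg_right (by positivity)
          · exact pow_le_pow_right₀ hK1 (by omega)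
  · have hx0 : 0 < ‖x‖ := by linarith
    have hz : -1 < ((((m : ℝ) - 1) / 2 : ℝ) + I * κ : ℂ).re := by
      simp only [add_re, ofReal_re, mul_re, I_re, I_im, ofReal_im]
      linarith
    rw [integral_prod _
      (integrable_sin_pow_mul_oscAmp hcd.continuous hsupp hz m t ‖x‖)]
    have e : ∀ r : ℝ, ∫ θ in Ioo 0 Real.pi, ((Real.sin θ ^ m : ℝ) : ℂ) *
        oscAmp χ ((((m : ℝ) - 1) / 2 : ℝ) + I * κ) (t + ‖x‖ * Real.cos θ) r =
        oscAmp χ ((((m : ℝ) - 1) / 2 : ℝ) + I * κ) t r * sphereSlice m (‖x‖ * r) := by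
      intro r
      rw [← integral_sin_pow_mul_exp_eq_sphereSlice, ← integral_const_mul]
      congr 1 with θ
      rw [oscAmp_add_mul, mul_right_comm ‖x‖]
      ring
    simp only [e]
    refine (h₂ κ t ‖x‖ hx0).trans ?_
    calc C₂ * (1 + |κ|) ^ N₂ * ‖x‖ ^ (-p) ≤ C₂ * (1 + |κ|) ^ N₂ * (|t| / 2) ^ (-p) := by
          gcongr C₂ * (1 + |κ|) ^ N₂ * ?_
          exact Real.rpow_le_rpow_of_nonpos (by positivity) (by linarith) (by linarith)
      _ = C₂ * 2 ^ p * (1 + |κ|) ^ N₂ * |t| ^ (-p) := by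
          rw [Real.div_rpow ht0.le two_pos.le, Real.rpow_neg two_pos.le, div_inv_eq_mul]
          ring
      _ ≤ (C₁ + C₂ * 2 ^ p) * (1 + |κ|) ^ (N₁ + N₂ + 1) * |t| ^ (-p) := by
          gcongr ?_ * ?_ * _
          · exact le_add_of_nonneg_left hC₁
          · exact pow_le_pow_right₀ hK1 (by omega)
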